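/- Theorem 5.15 (Haagerup). A complex Hadamard matrix of size $N$ is a matrix $H\in M_N(\mathbb{C})$ with $|H_{ij}|=1$ for all $i,j$, whose rows are pairwise orthogonal for $\langle x,y\rangle=\sum_k x_k\bar y_k$. Two such matrices $H,K$ are called equivalent when one can pass from $H$ to $K$ by finitely many operations of the following types: permuting the rows, permuting the columns, multiplying the rows by complex numbers of modulus one, multiplying the columns by complex numbers of modulus one. Let $F_5=(w^{ij})_{i,j=0,\dots,4}$ with $w=e^{2\pi i/5}$, that is, $$F_5=\begin{pmatrix}1&1&1&1&1\\1&w&w^2&w^3&w^4\\1&w^2&w^4&w&w^3\\1&w^3&w&w^4&w^2\\1&w^4&w^3&w^2&w\end{pmatrix}.$$ Then $F_5$ is a complex Hadamard matrix, and every complex Hadamard matrix $H\in M_5(\mathbb{C})$ is equivalent to $F_5$. -/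

import Mathlib

/-- Over `ℂ`, Mathlib's notion of Hadamard matrix is: the entries lie on the unit circle, and the
rows are pairwise orthogonal for the scalar product `⟨x, y⟩ = ∑ k, x k * conj (y k)`. -/
theorem isHadamard_complex_iff {N : ℕ} (H : Matrix (Fin N) (Fin N) ℂ) :
    H.IsHadamard ↔
      (∀ i j, ‖H i j‖ = 1) ∧
        ∀ i j, i ≠ j → ∑ k, H i k * (starRingEnd ℂ) (H j k) = 0 := by
  have hu : ∀ z : ℂ, z ∈ unitary ℂ ↔ ‖z‖ = 1 := by
    intro z
    rw [Unitary.mem_iff_self_mul_star, ← starRingEnd_apply, Complex.mul_conj,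
      Complex.normSq_eq_norm_sq]
    norm_cast
    exact pow_eq_one_iff_of_nonneg (norm_nonneg z) two_ne_zero
  constructor
  · intro h
    refine ⟨fun i j => (hu _).1 (h.apply_mem i j), fun i j hij => ?_⟩
    have := congrFun (congrFun h.mul_conjTranspose i) j
    simpa [Matrix.mul_apply, Matrix.one_apply, hij] using this
  · rintro ⟨h1, h2⟩
    rcases Nat.eq_zero_or_pos N with rfl | hN
    · exact ⟨fun i => i.elim0, Subsingleton.elim _ _, Subsingleton.elim _ _⟩
    refine Matrix.IsHadamard.of_mul_conjTranspose (fun i j => (hu _).2 (h1 i j)) ?_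
      (IsRegular.of_ne_zero (by simpa using hN.ne'))
    ext i j
    by_cases hij : i = j
    · subst hij
      simp [Matrix.mul_apply, Complex.mul_conj, Complex.normSq_eq_norm_sq, h1]
    · simpa [Matrix.mul_apply, Matrix.one_apply, hij] using h2 i j hij

/-- The elementary operations: permuting the rows, permuting the columns, multiplying each row, or
each column, by a complex number of modulus one. -/
inductive HadamardStep {N : ℕ} (H : Matrix (Fin N) (Fin N) ℂ) :
    Matrix (Fin N) (Fin N) ℂ → Prop
  | permRows (σ : Equiv.Perm (Fin N)) :
      HadamardStep H (Matrix.of fun i j => H (σ i) j)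
  | permCols (τ : Equiv.Perm (Fin N)) :
      HadamardStep H (Matrix.of fun i j => H i (τ j))
  | scaleRows (a : Fin N → Circle) :
      HadamardStep H (Matrix.of fun i j => (a i : ℂ) * H i j)
  | scaleCols (b : Fin N → Circle) :
      HadamardStep H (Matrix.of fun i j => H i j * (b j : ℂ))

/-- Equivalence: one can pass from `H` to `K` by finitely many elementary operations. -/
def HadamardEquivalent {N : ℕ} (H K : Matrix (Fin N) (Fin N) ℂ) : Prop :=
  Relation.ReflTransGen HadamardStep H K

/-- The Fourier matrix `(w ^ (i * j))` with `w = exp (2 π i / N)` and `i, j = 0, …, N - 1`. -/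
noncomputable def fourierMatrix (N : ℕ) : Matrix (Fin N) (Fin N) ℂ :=
  Matrix.of fun i j =>
    Complex.exp (2 * (Real.pi : ℂ) * Complex.I / (N : ℂ)) ^ ((i : ℕ) * (j : ℕ))

/-! Dephase the matrix. For three rows, the cyclic product of the scalar products over three columns
is minus the same product over the other two columns, and with two columns this product is invariant
under inverting all entries. Combining the resulting identity with its transpose gives
`minor_relation`: two of the three even diagonal products of a 3 × 3 minor agree. Exchanging two
columns gives the same for the odd ones.

A minor can therefore be brought to have inner rows (a, x) and (x, a). Orthogonality then fixes the
other entries up to one binary choice (`exists_normal_form`). By `minor_relation` again, the Klein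
four-group pattern is impossible (`not_klein`), while in the cyclic pattern squaring exchanges the
pairs {a, x} and {p, q}, which forces primitive fifth roots of unity
(`cyclotomic_five_of_doubling`). -/

/-! ### Equivalence and dephasing. -/

section Equivalence

variable {N : ℕ} {H K : Matrix (Fin N) (Fin N) ℂ}

theorem HadamardStep.isHadamard (h : HadamardStep H K) (hH : H.IsHadamard) : K.IsHadamard := by
  rw [isHadamard_complex_iff] at hH ⊢
  obtain ⟨h1, h2⟩ := hH
  cases h with
  | permRows σ => exact ⟨fun i j => h1 _ _, fun i j hij => h2 _ _ (σ.injective.ne hij)⟩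
  | permCols τ =>
    refine ⟨fun i j => h1 _ _, fun i j hij => ?_⟩
    rw [← h2 i j hij]
    exact Equiv.sum_comp τ fun k => H i k * (starRingEnd ℂ) (H j k)
  | scaleRows a =>
    refine ⟨fun i j => by simp [h1, Circle.norm_coe], fun i j hij => ?_⟩
    have := congrArg (fun z => (a i : ℂ) * (starRingEnd ℂ) (a j : ℂ) * z) (h2 i j hij)
    simp only [Finset.mul_sum, mul_zero] at this
    rw [← this]
    refine Finset.sum_congr rfl fun k _ => ?_
    simp only [Matrix.of_apply, map_mul]
    ring
  | scaleCols b =>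
    refine ⟨fun i j => by simp [h1, Circle.norm_coe], fun i j hij => ?_⟩
    rw [← h2 i j hij]
    refine Finset.sum_congr rfl fun k _ => ?_
    have hb : (b k : ℂ) * (starRingEnd ℂ) (b k : ℂ) = 1 := by
      simp [Complex.mul_conj, Complex.normSq_eq_norm_sq, Circle.norm_coe]
    simp only [Matrix.of_apply, map_mul]
    linear_combination (H i k * (starRingEnd ℂ) (H j k)) * hb

theorem HadamardEquivalent.isHadamard (h : HadamardEquivalent H K) (hH : H.IsHadamard) :
    K.IsHadamard := by
  induction h with
  | refl => exact hH
  | tail _ h ih => exact h.isHadamard ih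

theorem HadamardEquivalent.permute (H : Matrix (Fin N) (Fin N) ℂ) (σ τ : Equiv.Perm (Fin N)) :
    HadamardEquivalent H (Matrix.of fun i j => H (σ i) (τ j)) :=
  (Relation.ReflTransGen.single (HadamardStep.permRows σ)).tail (HadamardStep.permCols τ)

theorem HadamardEquivalent.scale (H : Matrix (Fin N) (Fin N) ℂ) {a b : Fin N → ℂ}
    (ha : ∀ i, ‖a i‖ = 1) (hb : ∀ j, ‖b j‖ = 1) :
    HadamardEquivalent H (Matrix.of fun i j => a i * H i j * b j) :=
  (Relation.ReflTransGen.single (HadamardStep.scaleRows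
    fun i => ⟨a i, mem_sphere_zero_iff_norm.2 (ha i)⟩)).tail
    (HadamardStep.scaleCols fun j => ⟨b j, mem_sphere_zero_iff_norm.2 (hb j)⟩)

end Equivalence

namespace Matrix.IsHadamard

variable {N : ℕ} {H : Matrix (Fin N) (Fin N) ℂ}

theorem norm_apply (hH : H.IsHadamard) (i j : Fin N) : ‖H i j‖ = 1 :=
  ((isHadamard_complex_iff H).1 hH).1 i j

theorem apply_ne_zero (hH : H.IsHadamard) (i j : Fin N) : H i j ≠ 0 := by
  rw [← norm_pos_iff, hH.norm_apply]
  exact one_pos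

theorem sum_mul_inv_row (hH : H.IsHadamard) {i j : Fin N} (hij : i ≠ j) :
    ∑ k, H i k * (H j k)⁻¹ = 0 := by
  rw [← ((isHadamard_complex_iff H).1 hH).2 i j hij]
  refine Finset.sum_congr rfl fun k _ => ?_
  rw [Complex.inv_eq_conj (hH.norm_apply j k)]

theorem sum_mul_inv_col (hH : H.IsHadamard) {i j : Fin N} (hij : i ≠ j) :
    ∑ k, H k i * (H k j)⁻¹ = 0 :=
  hH.transpose.sum_mul_inv_row hij

end Matrix.IsHadamard

/-- A matrix is dephased if its first row and first column consist of ones. -/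
structure Matrix.IsDephased {N : ℕ} [NeZero N] (H : Matrix (Fin N) (Fin N) ℂ) : Prop where
  col (i : Fin N) : H i 0 = 1
  row (j : Fin N) : H 0 j = 1

theorem Matrix.IsDephased.transpose {N : ℕ} [NeZero N] {H : Matrix (Fin N) (Fin N) ℂ}
    (h : H.IsDephased) : H.transpose.IsDephased := ⟨h.row, h.col⟩

/-- Any permutation of a Hadamard matrix may be dephased. -/
theorem Matrix.IsHadamard.exists_isDephased {N : ℕ} [NeZero N] {H : Matrix (Fin N) (Fin N) ℂ}
    (hH : H.IsHadamard) (σ τ : Equiv.Perm (Fin N)) :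
    ∃ K, HadamardEquivalent H K ∧ K.IsHadamard ∧ K.IsDephased ∧
      ∀ i j, K i j = (H (σ i) (τ 0))⁻¹ * H (σ i) (τ j) *
        (H (σ 0) (τ 0) * (H (σ 0) (τ j))⁻¹) := by
  have e : HadamardEquivalent H _ := (HadamardEquivalent.permute H σ τ).trans
    (HadamardEquivalent.scale _ (a := fun i => (H (σ i) (τ 0))⁻¹)
      -- The factor `H (σ 0) (τ 0)` compensates for the row scaling, which has already normalised
      -- the corner.
      (b := fun j => H (σ 0) (τ 0) * (H (σ 0) (τ j))⁻¹)
      (fun i => by simp [hH.norm_apply]) (fun j => by simp [hH.norm_apply]))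
  refine ⟨_, e, e.isHadamard hH, ⟨fun i => ?_, fun j => ?_⟩, fun i j => rfl⟩
  · simp [hH.apply_ne_zero]
  · have := hH.apply_ne_zero (σ 0) (τ 0)
    have := hH.apply_ne_zero (σ 0) (τ j)
    simp only [Matrix.of_apply]
    field_simp

/-! ### Identities between the entries of orthogonal rows. -/

section Algebra

variable {K : Type*} [Field K]

/-- For three rows of length five that are pairwise orthogonal, the cyclic product of the three
partial scalar products over the first three columns is real. -/
theorem partial_products_real {a x p q y b r s : K}
    (ha : a ≠ 0) (hx : x ≠ 0) (hp : p ≠ 0) (hq : q ≠ 0)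
    (hy : y ≠ 0) (hb : b ≠ 0) (hr : r ≠ 0) (hs : s ≠ 0)
    (h1 : 1 + a + x + p + q = 0) (h1' : 1 + a⁻¹ + x⁻¹ + p⁻¹ + q⁻¹ = 0)
    (h2 : 1 + y + b + r + s = 0) (h2' : 1 + y⁻¹ + b⁻¹ + r⁻¹ + s⁻¹ = 0)
    (h3 : 1 + a * y⁻¹ + x * b⁻¹ + p * r⁻¹ + q * s⁻¹ = 0)
    (h3' : 1 + y * a⁻¹ + b * x⁻¹ + r * p⁻¹ + s * q⁻¹ = 0) :
    (x - y) * (x - a * b) * (y - a * b) + (a - b) * (a - x * y) * (b - x * y) = 0 := by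
  have e1 : 1 + a + x = -(p + q) := by linear_combination h1
  have e1' : 1 + a⁻¹ + x⁻¹ = -(p⁻¹ + q⁻¹) := by linear_combination h1'
  have e2 : 1 + y + b = -(r + s) := by linear_combination h2
  have e2' : 1 + y⁻¹ + b⁻¹ = -(r⁻¹ + s⁻¹) := by linear_combination h2'
  have e3 : 1 + a * y⁻¹ + x * b⁻¹ = -(p * r⁻¹ + q * s⁻¹) := by linear_combination h3
  have e3' : 1 + y * a⁻¹ + b * x⁻¹ = -(r * p⁻¹ + s * q⁻¹) := by linear_combination h3'
  -- Over the last two columns both sides become -(p + q)(r + s)(ps + qr)/(pqrs).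
  have key : (1 + a + x) * (1 + y⁻¹ + b⁻¹) * (1 + y * a⁻¹ + b * x⁻¹) =
      (1 + a⁻¹ + x⁻¹) * (1 + y + b) * (1 + a * y⁻¹ + x * b⁻¹) := by
    rw [e1, e1', e2, e2', e3, e3']
    field_simp
    ring
  have hid : (x - y) * (x - a * b) * (y - a * b) + (a - b) * (a - x * y) * (b - x * y) =
      -(a * b * x * y) * ((1 + a + x) * (1 + y⁻¹ + b⁻¹) * (1 + y * a⁻¹ + b * x⁻¹) -
      (1 + a⁻¹ + x⁻¹) * (1 + y + b) * (1 + a * y⁻¹ + x * b⁻¹)) := by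
    field_simp
    ring
  rw [hid, key, sub_self, mul_zero]

/-- A nonzero sum and the sum of inverses determine the product, so both pairs are the roots of one
quadratic. -/
theorem pair_eq_of_sum_eq {p q r s : K} (hp : p ≠ 0) (hq : q ≠ 0) (hr : r ≠ 0) (hs : s ≠ 0)
    (h : p + q = r + s) (h' : p⁻¹ + q⁻¹ = r⁻¹ + s⁻¹) (h0 : p + q ≠ 0) :
    p = r ∧ q = s ∨ p = s ∧ q = r := by
  have hm : p * q = r * s := by
    have e : (p + q) * (r * s) = (r + s) * (p * q) := by
      field_simp at h'
      linear_combination h'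
    rw [← h] at e
    exact (mul_left_cancel₀ h0 e).symm
  have hz : (p - r) * (p - s) = 0 := by linear_combination p * h - hm
  rcases mul_eq_zero.1 hz with hz | hz
  · exact Or.inl ⟨sub_eq_zero.1 hz, by linear_combination h - hz⟩
  · exact Or.inr ⟨sub_eq_zero.1 hz, by linear_combination h - hz⟩

/-- The relations between the entries of the second row of the matrix with rows
`(1, a, b, c, d)`, `(1, b, a, d, c)`, `(1, c, d, a, b)`, `(1, d, c, b, a)` are contradictory. -/
theorem klein_relations_absurd {a b c d : K} (ha : a ≠ 0) (hb : b ≠ 0) (hc : c ≠ 0) (hd : d ≠ 0)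
    (hab : a ≠ b) (hac : a ≠ c) (had : a ≠ d) (hbc : b ≠ c) (hbd : b ≠ d) (hcd : c ≠ d)
    (h1 : a * d = b ∨ a * d = c) (h2 : b * c = a ∨ b * c = d)
    (h3 : a * c = b ∨ a * c = d) (h4 : b * d = a ∨ b * d = c)
    (h5 : a * b = c ∨ a * b = d) (h6 : c * d = a ∨ c * d = b) : False := by
  have a1 : a ≠ 1 := by rintro rfl; rw [one_mul] at h1; grind
  have b1 : b ≠ 1 := by rintro rfl; rw [one_mul] at h2; grind
  have c1 : c ≠ 1 := by rintro rfl; rw [one_mul] at h6; grind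
  have d1 : d ≠ 1 := by rintro rfl; rw [mul_one] at h1; grind
  -- Substituting one relation into the other makes a product of two entries equal to 1, whereas
  -- `h3`–`h6` make it an entry, and no entry is 1.
  rcases h1 with h1 | h1 <;> rcases h2 with h2 | h2
  · have : c * d = 1 := mul_left_cancel₀ ha (by rw [← h1] at h2; linear_combination h2)
    grind
  · have : a * c = 1 := mul_left_cancel₀ hd (by rw [← h1] at h2; linear_combination h2)
    grind
  · have : b * d = 1 := mul_left_cancel₀ ha (by rw [← h1] at h2; linear_combination h2)
    grind
  · have : a * b = 1 := mul_left_cancel₀ hd (by rw [← h1] at h2; linear_combination h2)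
    grind

end Algebra

theorem three_add_add_inv_ne_zero {z : ℂ} (hz : ‖z‖ = 1) : 3 + z + z⁻¹ ≠ 0 := by
  intro h
  have h3 : (3 : ℂ) = -(z + z⁻¹) := by linear_combination h
  have h4 := norm_add_le z z⁻¹
  rw [← norm_neg, ← h3, norm_inv, hz] at h4
  norm_num at h4

/-- Two orthogonal vectors `(1, a, x, p, q)` and `(1, x, a, q, p)` orthogonal to `(1, 1, 1, 1, 1)`
have the indicated entries distinct and nonopposite. -/
theorem swapped_row_ne {a x p q : ℂ} (ha : ‖a‖ = 1) (hx : ‖x‖ = 1) (hp : ‖p‖ = 1) (hq : ‖q‖ = 1)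
    (h1 : 1 + a + x + p + q = 0) (h1' : 1 + a⁻¹ + x⁻¹ + p⁻¹ + q⁻¹ = 0)
    (h : 1 + a * x⁻¹ + x * a⁻¹ + p * q⁻¹ + q * p⁻¹ = 0) :
    a ≠ x ∧ p ≠ q ∧ a + x ≠ 0 ∧ p + q ≠ 0 := by
  have ne : ∀ {z : ℂ}, ‖z‖ = 1 → z ≠ 0 := fun hz => norm_pos_iff.1 (by rw [hz]; exact one_pos)
  have ha0 := ne ha
  have hx0 := ne hx
  have hp0 := ne hp
  have hq0 := ne hq
  -- If x = -a, then p + q = -1 and pq = 1 give p/q + q/p = -1, but orthogonality requires 1.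
  have opp : ∀ {a x p q : ℂ}, a ≠ 0 → x ≠ 0 → p ≠ 0 → q ≠ 0 → 1 + a + x + p + q = 0 →
      1 + a⁻¹ + x⁻¹ + p⁻¹ + q⁻¹ = 0 → 1 + a * x⁻¹ + x * a⁻¹ + p * q⁻¹ + q * p⁻¹ = 0 →
      a + x ≠ 0 := by
    intro a x p q ha hx hp hq h1 h1' h h0
    obtain rfl : x = -a := by linear_combination h0
    have e1 : p + q = -1 := by linear_combination h1
    have e2 : p * q = 1 := by
      rw [inv_neg] at h1'
      have e : p⁻¹ + q⁻¹ = -1 := by linear_combination h1'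
      field_simp at e
      linear_combination e - e1
    have e3 : p * q⁻¹ + q * p⁻¹ = 1 := by
      have : a * (-a)⁻¹ = -1 := by field_simp
      have h' : -a * a⁻¹ = -1 := by field_simp
      linear_combination h - this - h'
    field_simp at e3
    have : (2 : ℂ) = 0 := by linear_combination (p + q - 1) * e1 - 3 * e2 - e3
    norm_num at this
  refine ⟨?_, ?_, opp ha0 hx0 hp0 hq0 h1 h1' h,
    opp hp0 hq0 ha0 hx0 (by linear_combination h1) (by linear_combination h1')
      (by linear_combination h)⟩
  · rintro rfl
    refine three_add_add_inv_ne_zero (z := p * q⁻¹) (by simp [hp, hq]) ?_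
    rw [mul_inv_cancel₀ ha0] at h
    rw [mul_inv, inv_inv]
    linear_combination h
  · rintro rfl
    refine three_add_add_inv_ne_zero (z := a * x⁻¹) (by simp [ha, hx]) ?_
    rw [mul_inv_cancel₀ hp0] at h
    rw [mul_inv, inv_inv]
    linear_combination h

/-- If the second and third rows begin with `(1, a, x)` and `(1, x, a)`, then the remaining two
entries of the third row are those of the second row, exchanged. -/
theorem swapped_row_eq {a x p q r s : ℂ} (ha : ‖a‖ = 1) (hx : ‖x‖ = 1) (hp : ‖p‖ = 1)
    (hq : ‖q‖ = 1) (hr : ‖r‖ = 1) (hs : ‖s‖ = 1)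
    (h1 : 1 + a + x + p + q = 0) (h1' : 1 + a⁻¹ + x⁻¹ + p⁻¹ + q⁻¹ = 0)
    (h2 : 1 + x + a + r + s = 0) (h2' : 1 + x⁻¹ + a⁻¹ + r⁻¹ + s⁻¹ = 0)
    (h : 1 + a * x⁻¹ + x * a⁻¹ + p * r⁻¹ + q * s⁻¹ = 0) : r = q ∧ s = p := by
  have ne : ∀ {z : ℂ}, ‖z‖ = 1 → z ≠ 0 := fun hz => norm_pos_iff.1 (by rw [hz]; exact one_pos)
  have ha0 := ne ha
  have hx0 := ne hx
  have hp0 := ne hp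
  have hq0 := ne hq
  have hr0 := ne hr
  have hs0 := ne hs
  -- Otherwise a and x are the two primitive cube roots of unity, 1 + a/x + x/a vanishes, and 2p/r =
  -- 0 remains.
  have hpq : p + q ≠ 0 := by
    intro h0
    obtain rfl : q = -p := by linear_combination h0
    obtain rfl : s = -r := by linear_combination h2 - h1
    have e1 : a + x = -1 := by linear_combination h1
    have e2 : a * x = 1 := by
      rw [inv_neg] at h1'
      have e : a⁻¹ + x⁻¹ = -1 := by linear_combination h1'
      field_simp at e
      linear_combination e - e1
    have e3 : a * x⁻¹ + x * a⁻¹ = -1 := by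
      field_simp
      linear_combination (a + x - 1) * e1 - e2
    have e4 : 2 * p = 0 := by
      have h5 : -p * (-r)⁻¹ = p * r⁻¹ := by field_simp
      have h6 : 2 * (p * r⁻¹) = 0 := by linear_combination h - e3 - h5
      field_simp at h6
      linear_combination h6
    simp [hp0] at e4
  rcases pair_eq_of_sum_eq hp0 hq0 hr0 hs0 (by linear_combination h1 - h2)
    (by linear_combination h1' - h2') hpq with ⟨rfl, rfl⟩ | ⟨rfl, rfl⟩
  · rw [mul_inv_cancel₀ hp0, mul_inv_cancel₀ hq0] at h
    refine absurd ?_ (three_add_add_inv_ne_zero (z := a * x⁻¹) (by simp [ha, hx]))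
    rw [mul_inv, inv_inv]
    linear_combination h
  · exact ⟨rfl, rfl⟩

theorem cyclotomic_five_of_doubling {p a q x : ℂ} (hp0 : p ≠ 0) (hq0 : q ≠ 0) (hpq : p ≠ q)
    (hpa : p ^ 2 = a) (hqx : q ^ 2 = x) (ha : a ^ 2 = p ∧ x ^ 2 = q ∨ a ^ 2 = q ∧ x ^ 2 = p)
    (h1 : 1 + a + x + p + q = 0) :
    1 + p + p ^ 2 + p ^ 3 + p ^ 4 = 0 ∧ a = p ^ 2 ∧ q = p ^ 4 ∧ x = p ^ 3 := by
  subst hpa hqx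
  rcases ha with ⟨h2, h3⟩ | ⟨h2, h3⟩
  -- Here p and q are distinct cube roots of unity, so p + p² and q + q² are -1 or 2, not both 2,
  -- and the sum in `h1` is -1 or 2.
  · exfalso
    grind
  · subst h2
    have h15 : p ^ 15 = 1 := mul_left_cancel₀ hp0 (by linear_combination h3)
    -- The coefficients are Bézout's: the fifth cyclotomic polynomial is the gcd of X¹⁵ - 1 and 1 +
    -- X + X² + X⁴ + X⁸.
    have hc : 1 + p + p ^ 2 + p ^ 3 + p ^ 4 = 0 := by
      linear_combination (p ^ 2 / 2 - p ^ 3 / 2) * h15 +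
        (1 + p ^ 2 / 2 - p ^ 4 / 2 + p ^ 5 / 2 - p ^ 6 / 2 - p ^ 9 / 2 + p ^ 10 / 2) * h1
    refine ⟨hc, rfl, by ring, ?_⟩
    linear_combination (p - 1) * p ^ 3 * hc

/-! ### Minors and the normal form. -/

theorem exists_univ_fin_five_eq {k l : Fin 5} (hk : k ≠ 0) (hl : l ≠ 0) (hkl : k ≠ l) :
    ∃ m n : Fin 5, (Finset.univ : Finset (Fin 5)) = {0, k, l, m, n} ∧
      0 ∉ ({k, l, m, n} : Finset (Fin 5)) ∧ k ∉ ({l, m, n} : Finset (Fin 5)) ∧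
      l ∉ ({m, n} : Finset (Fin 5)) ∧ m ∉ ({n} : Finset (Fin 5)) := by
  revert k l
  decide

theorem exists_sum_fin_five_eq {k l : Fin 5} (hk : k ≠ 0) (hl : l ≠ 0) (hkl : k ≠ l) :
    ∃ m n : Fin 5, ∀ f : Fin 5 → ℂ, ∑ c, f c = f 0 + f k + f l + f m + f n := by
  obtain ⟨m, n, h, h0, h1, h2, h3⟩ := exists_univ_fin_five_eq hk hl hkl
  refine ⟨m, n, fun f => ?_⟩
  rw [h, Finset.sum_insert h0, Finset.sum_insert h1, Finset.sum_insert h2, Finset.sum_insert h3,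
    Finset.sum_singleton]
  ring

section Five

variable {H : Matrix (Fin 5) (Fin 5) ℂ}

theorem Matrix.IsHadamard.minor_relation_sum (hH : H.IsHadamard) (hD : H.IsDephased)
    {i j k l : Fin 5} (hi : i ≠ 0) (hj : j ≠ 0) (hij : i ≠ j) (hk : k ≠ 0) (hl : l ≠ 0)
    (hkl : k ≠ l) :
    (H i l - H j k) * (H i l - H i k * H j l) * (H j k - H i k * H j l) +
      (H i k - H j l) * (H i k - H i l * H j k) * (H j l - H i l * H j k) = 0 := by
  obtain ⟨m, n, hs⟩ := exists_sum_fin_five_eq hk hl hkl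
  have hn := hH.apply_ne_zero
  have h1 := hH.sum_mul_inv_row hi
  have h1' := hH.sum_mul_inv_row hi.symm
  have h2 := hH.sum_mul_inv_row hj
  have h2' := hH.sum_mul_inv_row hj.symm
  have h3 := hH.sum_mul_inv_row hij
  have h3' := hH.sum_mul_inv_row hij.symm
  simp only [hs, hD.col, hD.row, inv_one, mul_one, one_mul] at h1 h1' h2 h2' h3 h3'
  exact partial_products_real (hn i k) (hn i l) (hn i m) (hn i n) (hn j k) (hn j l) (hn j m)
    (hn j n) h1 h1' h2 h2' h3 h3'

/-- **Haagerup's identity**: in a dephased complex Hadamard matrix of order five, the three even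
diagonal products of a `3 × 3` minor containing the first row and column are not distinct. -/
theorem Matrix.IsHadamard.minor_relation (hH : H.IsHadamard) (hD : H.IsDephased)
    {i j k l : Fin 5} (hi : i ≠ 0) (hj : j ≠ 0) (hij : i ≠ j) (hk : k ≠ 0) (hl : l ≠ 0)
    (hkl : k ≠ l) :
    H i l = H j k ∨ H i l = H i k * H j l ∨ H j k = H i k * H j l := by
  have h1 := hH.minor_relation_sum hD hi hj hij hk hl hkl
  have h2 := hH.transpose.minor_relation_sum hD.transpose hk hl hkl hi hj hij
  simp only [Matrix.transpose_apply] at h2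
  -- Transposition changes the sign of the first summand and fixes the second.
  have h : (H i l - H j k) * ((H i l - H i k * H j l) * (H j k - H i k * H j l)) = 0 := by
    linear_combination (h1 - h2) / 2
  simpa only [mul_eq_zero, sub_eq_zero] using h

theorem Matrix.IsHadamard.exists_swapped_minor (hH : H.IsHadamard) :
    ∃ K, HadamardEquivalent H K ∧ K.IsHadamard ∧ K.IsDephased ∧
      K 2 2 = K 1 1 ∧ K 2 1 = K 1 2 := by
  obtain ⟨L, hHL, hL, hD, -⟩ := hH.exists_isDephased 1 1
  have h1 := hL.minor_relation hD (i := 1) (j := 2) (k := 1) (l := 2)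
    (by decide) (by decide) (by decide) (by decide) (by decide) (by decide)
  have h2 := hL.minor_relation hD (i := 1) (j := 2) (k := 2) (l := 1)
    (by decide) (by decide) (by decide) (by decide) (by decide) (by decide)
  -- Cyclic permutations of the three rows and columns move any coinciding even pair and odd pair to
  -- the required positions.
  have key : ∀ σ τ : Equiv.Perm (Fin 5),
      L (σ 0) (τ 1) * L (σ 1) (τ 0) * L (σ 2) (τ 2) =
        L (σ 0) (τ 2) * L (σ 1) (τ 1) * L (σ 2) (τ 0) →
      L (σ 0) (τ 1) * L (σ 1) (τ 2) * L (σ 2) (τ 0) =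
        L (σ 0) (τ 2) * L (σ 1) (τ 0) * L (σ 2) (τ 1) →
      ∃ K, HadamardEquivalent H K ∧ K.IsHadamard ∧ K.IsDephased ∧
        K 2 2 = K 1 1 ∧ K 2 1 = K 1 2 := by
    intro σ τ e1 e2
    obtain ⟨K, hLK, hK, hKD, hKe⟩ := hL.exists_isDephased σ τ
    have hn := hL.apply_ne_zero
    have := hn (σ 0) (τ 0)
    have := hn (σ 0) (τ 1)
    have := hn (σ 0) (τ 2)
    have := hn (σ 1) (τ 0)
    have := hn (σ 2) (τ 0)
    refine ⟨K, hHL.trans hLK, hK, hKD, ?_, ?_⟩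
    · rw [hKe, hKe]
      field_simp
      linear_combination e1
    · rw [hKe, hKe]
      field_simp
      linear_combination -e2
  let c : Equiv.Perm (Fin 5) := Equiv.swap 0 1 * Equiv.swap 1 2
  let d : Equiv.Perm (Fin 5) := Equiv.swap 1 2 * Equiv.swap 0 1
  have c0 : c 0 = 1 := by decide
  have c1 : c 1 = 2 := by decide
  have c2 : c 2 = 0 := by decide
  have d0 : d 0 = 2 := by decide
  have d1 : d 1 = 0 := by decide
  have d2 : d 2 = 1 := by decide
  rcases h1 with h1 | h1 | h1 <;> rcases h2 with h2 | h2 | h2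
  · refine key 1 1 ?_ ?_ <;> simp only [Equiv.Perm.one_apply, hD.row, hD.col] <;> grind
  · refine key d d ?_ ?_ <;> simp only [d0, d1, d2, hD.row, hD.col] <;> grind
  · refine key c c ?_ ?_ <;> simp only [c0, c1, c2, hD.row, hD.col] <;> grind
  · refine key d c ?_ ?_ <;> simp only [c0, c1, c2, d0, d1, d2, hD.row, hD.col] <;> grind
  · refine key c 1 ?_ ?_ <;> simp only [Equiv.Perm.one_apply, c0, c1, c2, hD.row, hD.col] <;> grind
  · refine key 1 d ?_ ?_ <;> simp only [Equiv.Perm.one_apply, d0, d1, d2, hD.row, hD.col] <;> grind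
  · refine key c d ?_ ?_ <;> simp only [c0, c1, c2, d0, d1, d2, hD.row, hD.col] <;> grind
  · refine key 1 c ?_ ?_ <;> simp only [Equiv.Perm.one_apply, c0, c1, c2, hD.row, hD.col] <;> grind
  · refine key d 1 ?_ ?_ <;> simp only [Equiv.Perm.one_apply, d0, d1, d2, hD.row, hD.col] <;> grind

theorem Matrix.IsHadamard.swapped_rows (hH : H.IsHadamard) (hD : H.IsDephased)
    (h22 : H 2 2 = H 1 1) (h21 : H 2 1 = H 1 2) :
    H 2 3 = H 1 4 ∧ H 2 4 = H 1 3 ∧ H 1 1 ≠ H 1 2 ∧ H 1 3 ≠ H 1 4 ∧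
      H 1 1 + H 1 2 ≠ 0 ∧ H 1 3 + H 1 4 ≠ 0 := by
  have h1 := hH.sum_mul_inv_row (i := 1) (j := 0) (by decide)
  have h1' := hH.sum_mul_inv_row (i := 0) (j := 1) (by decide)
  have h2 := hH.sum_mul_inv_row (i := 2) (j := 0) (by decide)
  have h2' := hH.sum_mul_inv_row (i := 0) (j := 2) (by decide)
  have h3 := hH.sum_mul_inv_row (i := 1) (j := 2) (by decide)
  simp only [Fin.sum_univ_five, hD.col, hD.row, h22, h21, inv_one, mul_one, one_mul]
    at h1 h1' h2 h2' h3
  have hn := hH.norm_apply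
  obtain ⟨e1, e2⟩ := swapped_row_eq (hn 1 1) (hn 1 2) (hn 1 3) (hn 1 4) (hn 2 3) (hn 2 4)
    h1 h1' h2 h2' h3
  rw [e1, e2] at h3
  exact ⟨e1, e2, swapped_row_ne (hn 1 1) (hn 1 2) (hn 1 3) (hn 1 4) h1 h1' h3⟩

/-- A dephased matrix whose upper left `3 × 3` minor is symmetric with constant inner diagonal
is, up to exchanging the last two rows, determined by its second row and one corner entry. -/
theorem Matrix.IsHadamard.exists_normal_form (hH : H.IsHadamard) :
    ∃ K, HadamardEquivalent H K ∧ K.IsHadamard ∧ K.IsDephased ∧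
      K 1 1 ≠ K 1 2 ∧ K 1 3 ≠ K 1 4 ∧ K 1 1 + K 1 2 ≠ 0 ∧ K 1 3 + K 1 4 ≠ 0 ∧
      K 2 1 = K 1 2 ∧ K 2 2 = K 1 1 ∧ K 2 3 = K 1 4 ∧ K 2 4 = K 1 3 ∧
      K 3 1 = K 1 3 ∧ K 3 2 = K 1 4 ∧ K 4 1 = K 1 4 ∧ K 4 2 = K 1 3 ∧
      (K 3 3 = K 1 1 ∧ K 3 4 = K 1 2 ∧ K 4 3 = K 1 2 ∧ K 4 4 = K 1 1 ∨
        K 3 3 = K 1 2 ∧ K 3 4 = K 1 1 ∧ K 4 3 = K 1 1 ∧ K 4 4 = K 1 2) := by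
  obtain ⟨L, hHL, hL, hLD, h22, h21⟩ := hH.exists_swapped_minor
  have hex : ∃ K, HadamardEquivalent H K ∧ K.IsHadamard ∧ K.IsDephased ∧
      K 2 2 = K 1 1 ∧ K 2 1 = K 1 2 ∧ K 3 1 = K 1 3 ∧ K 4 1 = K 1 4 := by
    obtain ⟨-, -, -, -, -, h0⟩ := hL.swapped_rows hLD h22 h21
    have h1 := hL.sum_mul_inv_row (i := 1) (j := 0) (by decide)
    have h1' := hL.sum_mul_inv_row (i := 0) (j := 1) (by decide)
    have h2 := hL.sum_mul_inv_col (i := 1) (j := 0) (by decide)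
    have h2' := hL.sum_mul_inv_col (i := 0) (j := 1) (by decide)
    simp only [Fin.sum_univ_five, hLD.col, hLD.row, h21, inv_one, mul_one, one_mul]
      at h1 h1' h2 h2'
    have hn := hL.apply_ne_zero
    rcases pair_eq_of_sum_eq (hn 1 3) (hn 1 4) (hn 3 1) (hn 4 1) (by linear_combination h1 - h2)
      (by linear_combination h1' - h2') h0 with ⟨e1, e2⟩ | ⟨e1, e2⟩
    · exact ⟨L, hHL, hL, hLD, h22, h21, e1.symm, e2.symm⟩
    · have s0 : Equiv.swap (3 : Fin 5) 4 0 = 0 := by decide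
      have s1 : Equiv.swap (3 : Fin 5) 4 1 = 1 := by decide
      have s2 : Equiv.swap (3 : Fin 5) 4 2 = 2 := by decide
      have s3 : Equiv.swap (3 : Fin 5) 4 3 = 4 := by decide
      have s4 : Equiv.swap (3 : Fin 5) 4 4 = 3 := by decide
      obtain ⟨K, hLK, hK, hKD, hKe⟩ := hL.exists_isDephased (Equiv.swap 3 4) 1
      simp only [Equiv.Perm.one_apply, hLD.col, hLD.row, s0, inv_one, one_mul, mul_one] at hKe
      exact ⟨K, hHL.trans hLK, hK, hKD, by simp only [hKe, s1, s2, h22],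
        by simp only [hKe, s1, s2, h21], by simp only [hKe, s1, s3, e1],
        by simp only [hKe, s1, s4, e2]⟩
  obtain ⟨K, hHK, hK, hKD, h22, h21, h31, h41⟩ := hex
  obtain ⟨h23, h24, n1, n2, n3, n4⟩ := hK.swapped_rows hKD h22 h21
  obtain ⟨h32, h42, -⟩ := hK.transpose.swapped_rows hKD.transpose h22 h21.symm
  simp only [Matrix.transpose_apply] at h32 h42
  rw [h41] at h32
  rw [h31] at h42
  refine ⟨K, hHK, hK, hKD, n1, n2, n3, n4, h21, h22, h23, h24, h31, h32, h41, h42, ?_⟩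
  have h1 := hK.sum_mul_inv_row (i := 1) (j := 0) (by decide)
  have h1' := hK.sum_mul_inv_row (i := 0) (j := 1) (by decide)
  have r3 := hK.sum_mul_inv_row (i := 3) (j := 0) (by decide)
  have r3' := hK.sum_mul_inv_row (i := 0) (j := 3) (by decide)
  have c3 := hK.sum_mul_inv_col (i := 3) (j := 0) (by decide)
  have c4 := hK.sum_mul_inv_col (i := 4) (j := 0) (by decide)
  simp only [Fin.sum_univ_five, hKD.col, hKD.row, h23, h24, h31, h32, inv_one, mul_one, one_mul]
    at h1 h1' r3 r3' c3 c4
  have hn := hK.apply_ne_zero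
  rcases pair_eq_of_sum_eq (hn 1 1) (hn 1 2) (hn 3 3) (hn 3 4) (by linear_combination h1 - r3)
    (by linear_combination h1' - r3') n3 with ⟨e1, e2⟩ | ⟨e1, e2⟩
  · refine Or.inl ⟨e1.symm, e2.symm, ?_, ?_⟩
    · linear_combination c3 - h1 + e1
    · linear_combination c4 - h1 + e2
  · refine Or.inr ⟨e2.symm, e1.symm, ?_, ?_⟩
    · linear_combination c3 - h1 + e2
    · linear_combination c4 - h1 + e1

end Five

/-! ### The Fourier matrix. -/

theorem isHadamard_fourierMatrix (N : ℕ) [NeZero N] : (fourierMatrix N).IsHadamard := by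
  have hw := Complex.isPrimitiveRoot_exp N (NeZero.ne N)
  rw [isHadamard_complex_iff]
  simp only [fourierMatrix, Matrix.of_apply]
  set w := Complex.exp (2 * (Real.pi : ℂ) * Complex.I / (N : ℂ)) with hwdef
  have hn : ‖w‖ = 1 := hw.norm'_eq_one (NeZero.ne N)
  refine ⟨fun i j => by simp [hn], fun i j hij => ?_⟩
  have h0 : w ≠ 0 := hw.ne_zero (NeZero.ne N)
  set z := w ^ (i : ℕ) * (w ^ (j : ℕ))⁻¹ with hz
  have hzN : z ^ N = 1 := by
    rw [hz, mul_pow, inv_pow, ← pow_mul, ← pow_mul, mul_comm _ N, mul_comm _ N, pow_mul, pow_mul,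
      hw.pow_eq_one, one_pow, one_pow, inv_one, mul_one]
  have hz1 : z - 1 ≠ 0 := by
    intro h
    refine hij (Fin.ext (hw.pow_inj i.2 j.2 ?_))
    exact (mul_inv_eq_one₀ (pow_ne_zero _ h0)).1 (sub_eq_zero.1 h)
  have hs : ∑ k : Fin N, w ^ ((i : ℕ) * (k : ℕ)) * (starRingEnd ℂ) (w ^ ((j : ℕ) * (k : ℕ))) =
      ∑ k ∈ Finset.range N, z ^ k := by
    rw [← Fin.sum_univ_eq_sum_range (fun k => z ^ k)]
    refine Finset.sum_congr rfl fun k _ => ?_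
    rw [← Complex.inv_eq_conj (by simp [hn]), pow_mul, pow_mul, ← inv_pow, ← mul_pow]
  rw [hs]
  refine mul_left_cancel₀ hz1 ?_
  rw [mul_geom_sum, hzN, sub_self, mul_zero]

theorem exists_perm_mul_fin_five {k : Fin 5} (hk : k ≠ 0) :
    ∃ σ : Equiv.Perm (Fin 5), ∀ i, k * σ i = i := by
  have h : Function.Bijective fun i : Fin 5 => k * i := by
    revert k
    decide
  exact ⟨(Equiv.ofBijective _ h).symm, fun i => (Equiv.ofBijective _ h).apply_symm_apply i⟩

theorem pow_val_mul_fin_five {p : ℂ} (hp : p ^ 5 = 1) (i j : Fin 5) :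
    p ^ ((i * j : Fin 5) : ℕ) = p ^ ((i : ℕ) * (j : ℕ)) := by
  rw [Fin.val_mul, ← pow_mod_orderOf p ((i : ℕ) * j),
    ← Nat.mod_mod_of_dvd _ (orderOf_dvd_of_pow_eq_one hp), pow_mod_orderOf]

/-- Since p = w ^ k with k invertible modulo 5, a row permutation absorbs k. -/
theorem hadamardEquivalent_fourierMatrix_five {H : Matrix (Fin 5) (Fin 5) ℂ} {p : ℂ}
    (hp : 1 + p + p ^ 2 + p ^ 3 + p ^ 4 = 0) (ρ κ : Equiv.Perm (Fin 5))
    (h : ∀ i j, H i j = p ^ ((ρ i * κ j : Fin 5) : ℕ)) :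
    HadamardEquivalent H (fourierMatrix 5) := by
  have hp5 : p ^ 5 = 1 := by linear_combination (p - 1) * hp
  have hw := Complex.isPrimitiveRoot_exp 5 (by norm_num)
  obtain ⟨k, hk, rfl⟩ := hw.eq_pow_of_pow_eq_one hp5
  lift k to Fin 5 using hk
  have hk0 : k ≠ 0 := by
    rintro rfl
    norm_num at hp
  obtain ⟨σ, hσ⟩ := exists_perm_mul_fin_five hk0
  convert HadamardEquivalent.permute H (σ.trans ρ.symm) κ.symm using 1
  ext i j
  simp only [fourierMatrix, Matrix.of_apply, h, Equiv.trans_apply, Equiv.apply_symm_apply]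
  rw [← pow_mul, ← pow_val_mul_fin_five hw.pow_eq_one, ← pow_val_mul_fin_five hw.pow_eq_one,
    ← mul_assoc, hσ]

/-! ### The two normal forms. -/

section Five

variable {H : Matrix (Fin 5) (Fin 5) ℂ}

theorem Matrix.IsHadamard.not_klein (hH : H.IsHadamard) (hD : H.IsDephased)
    (h21 : H 2 1 = H 1 2) (h22 : H 2 2 = H 1 1) (h23 : H 2 3 = H 1 4) (h24 : H 2 4 = H 1 3)
    (h31 : H 3 1 = H 1 3) (h32 : H 3 2 = H 1 4) (h33 : H 3 3 = H 1 1) (h34 : H 3 4 = H 1 2)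
    (h41 : H 4 1 = H 1 4) (h42 : H 4 2 = H 1 3) (h43 : H 4 3 = H 1 2) (h44 : H 4 4 = H 1 1) :
    False := by
  have hn := hH.norm_apply
  have h0 := hH.apply_ne_zero
  have h1 := hH.sum_mul_inv_row (i := 1) (j := 0) (by decide)
  have h1' := hH.sum_mul_inv_row (i := 0) (j := 1) (by decide)
  have r12 := hH.sum_mul_inv_row (i := 1) (j := 2) (by decide)
  have r13 := hH.sum_mul_inv_row (i := 1) (j := 3) (by decide)
  have r14 := hH.sum_mul_inv_row (i := 1) (j := 4) (by decide)
  have mr : ∀ i j k l : Fin 5, i ≠ 0 ∧ j ≠ 0 ∧ i ≠ j ∧ k ≠ 0 ∧ l ≠ 0 ∧ k ≠ l →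
      H i l = H j k ∨ H i l = H i k * H j l ∨ H j k = H i k * H j l :=
    fun i j k l ⟨hi, hj, hij, hk, hl, hkl⟩ => hH.minor_relation hD hi hj hij hk hl hkl
  have m1 := mr 1 3 1 2 (by decide)
  have m2 := mr 1 3 2 1 (by decide)
  have m3 := mr 1 2 1 4 (by decide)
  have m4 := mr 1 2 4 1 (by decide)
  have m5 := mr 1 3 1 4 (by decide)
  have m6 := mr 1 3 4 1 (by decide)
  simp only [Fin.sum_univ_five, hD.col, hD.row, h21, h22, h23, h24, h31, h32, h33, h34, h41, h42,
    h43, h44, inv_one, mul_one, one_mul] at h1 h1' r12 r13 r14 m1 m2 m3 m4 m5 m6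
  obtain ⟨n12, n34, -⟩ := swapped_row_ne (hn 1 1) (hn 1 2) (hn 1 3) (hn 1 4) h1 h1'
    (by linear_combination r12)
  obtain ⟨n13, n24, -⟩ := swapped_row_ne (hn 1 1) (hn 1 3) (hn 1 2) (hn 1 4)
    (by linear_combination h1) (by linear_combination h1') (by linear_combination r13)
  obtain ⟨n14, n23, -⟩ := swapped_row_ne (hn 1 1) (hn 1 4) (hn 1 2) (hn 1 3)
    (by linear_combination h1) (by linear_combination h1') (by linear_combination r14)
  exact klein_relations_absurd (h0 1 1) (h0 1 2) (h0 1 3) (h0 1 4) n12 n13 n14 n23 n24 n34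
    (by grind) (by grind) (by grind) (by grind) (by grind) (by grind)

theorem Matrix.IsHadamard.equivalent_fourierMatrix_of_cyclic (hH : H.IsHadamard)
    (hD : H.IsDephased) (n12 : H 1 1 ≠ H 1 2) (n34 : H 1 3 ≠ H 1 4) (s12 : H 1 1 + H 1 2 ≠ 0)
    (s34 : H 1 3 + H 1 4 ≠ 0)
    (h21 : H 2 1 = H 1 2) (h22 : H 2 2 = H 1 1) (h23 : H 2 3 = H 1 4) (h24 : H 2 4 = H 1 3)
    (h31 : H 3 1 = H 1 3) (h32 : H 3 2 = H 1 4) (h33 : H 3 3 = H 1 2) (h34 : H 3 4 = H 1 1)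
    (h41 : H 4 1 = H 1 4) (h42 : H 4 2 = H 1 3) (h43 : H 4 3 = H 1 1) (h44 : H 4 4 = H 1 2) :
    HadamardEquivalent H (fourierMatrix 5) := by
  have h0 := hH.apply_ne_zero
  have h1 := hH.sum_mul_inv_row (i := 1) (j := 0) (by decide)
  have mr : ∀ i j k l : Fin 5, i ≠ 0 ∧ j ≠ 0 ∧ i ≠ j ∧ k ≠ 0 ∧ l ≠ 0 ∧ k ≠ l →
      H i l = H j k ∨ H i l = H i k * H j l ∨ H j k = H i k * H j l :=
    fun i j k l ⟨hi, hj, hij, hk, hl, hkl⟩ => hH.minor_relation hD hi hj hij hk hl hkl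
  -- These minors put p² and q² in {a, x}, and a² and x² in {p, q}.
  have mp := mr 1 3 3 1 (by decide)
  have mx := mr 2 3 1 3 (by decide)
  have mq := mr 1 4 4 1 (by decide)
  have ma := mr 1 4 1 3 (by decide)
  simp only [Fin.sum_univ_five, hD.col, hD.row, h21, h23, h31, h33, h41, h43, h44, inv_one,
    mul_one, n12, n34, n34.symm, false_or, ← pow_two] at h1 mp mx mq ma
  have sq_ne : ∀ {u v : ℂ}, u ≠ v → u + v ≠ 0 → u ^ 2 ≠ v ^ 2 := by
    intro u v huv huv' h
    rcases sq_eq_sq_iff_eq_or_eq_neg.1 h with h | h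
    · exact huv h
    · exact huv' (by rw [h, neg_add_cancel])
  have sq12 := sq_ne n12 s12
  have sq34 := sq_ne n34 s34
  have hax : H 1 1 ^ 2 = H 1 3 ∧ H 1 2 ^ 2 = H 1 4 ∨ H 1 1 ^ 2 = H 1 4 ∧ H 1 2 ^ 2 = H 1 3 := by
    grind
  have hpq : H 1 3 ^ 2 = H 1 1 ∧ H 1 4 ^ 2 = H 1 2 ∨ H 1 3 ^ 2 = H 1 2 ∧ H 1 4 ^ 2 = H 1 1 := by
    grind
  rcases hpq with ⟨hp, hq⟩ | ⟨hp, hq⟩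
  · obtain ⟨hc, e1, e4, e2⟩ := cyclotomic_five_of_doubling (h0 1 3) (h0 1 4) n34 hp hq hax
      (by linear_combination h1)
    -- The lists are the exponents of p = `H 1 3` in column 3 and in row 1.
    refine hadamardEquivalent_fourierMatrix_five hc
      (Equiv.ofBijective ![0, 1, 4, 3, 2] (by decide))
      (Equiv.ofBijective ![0, 2, 3, 1, 4] (by decide)) fun i j => ?_
    fin_cases i <;> fin_cases j <;>
      simp [hD.row, hD.col, h21, h22, h23, h24, h31, h32, h33, h34, h41, h42, h43, h44, e1, e2, e4]
  · obtain ⟨hc, e1, e4, e2⟩ := cyclotomic_five_of_doubling (h0 1 3) (h0 1 4) n34 hp hq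
      (by tauto) (by linear_combination h1)
    refine hadamardEquivalent_fourierMatrix_five hc
      (Equiv.ofBijective ![0, 1, 4, 2, 3] (by decide))
      (Equiv.ofBijective ![0, 3, 2, 1, 4] (by decide)) fun i j => ?_
    fin_cases i <;> fin_cases j <;>
      simp [hD.row, hD.col, h21, h22, h23, h24, h31, h32, h33, h34, h41, h42, h43, h44, e1, e2, e4]

end Five

theorem theorem5p15 :
    (fourierMatrix 5).IsHadamard ∧
      ∀ H : Matrix (Fin 5) (Fin 5) ℂ, H.IsHadamard →
        HadamardEquivalent H (fourierMatrix 5) := by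
  refine ⟨isHadamard_fourierMatrix 5, fun H hH => ?_⟩
  obtain ⟨K, hHK, hK, hD, n1, n2, n3, n4, h21, h22, h23, h24, h31, h32, h41, h42, hc⟩ :=
    hH.exists_normal_form
  rcases hc with ⟨h33, h34, h43, h44⟩ | ⟨h33, h34, h43, h44⟩
  · exact (hK.not_klein hD h21 h22 h23 h24 h31 h32 h33 h34 h41 h42 h43 h44).elim
  · exact hHK.trans (hK.equivalent_fourierMatrix_of_cyclic hD n1 n2 n3 n4 h21 h22 h23 h24 h31 h32
      h33 h34 h41 h42 h43 h44)
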